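/- Consider the equation $$\ddot x(t)+a(t)\dot x(t)+b(t)x(t)+a_1(t)\dot x(g(t))+b_1(t)x(h(t))=0,\qquad t\ge 0, \tag{$*$}$$ where $a,b,a_1,b_1$ are Lebesgue measurable and essentially bounded on $[0,\infty)$ and $g,h:[0,\infty)\to\mathbb R$ are Lebesgue measurable with $g(t)\le t$, $h(t)\le t$ for $t\ge 0$. For $s\ge 0$, Borel measurable bounded functions $\varphi,\psi:(-\infty,s)\to\mathbb R$ and $x_0,x_0'\in\mathbb R$, a solution of $(*)$ with initial data $(s,\varphi,\psi,x_0,x_0')$ is a function $x$ which is differentiable on $[s,\infty)$ with locally absolutely continuous derivative $\dot x$, satisfies $x(s)=x_0$, $\dot x(s)=x_0'$, and satisfies $(*)$ for almost every $t\ge s$, where $x(t)=\varphi(t)$ and $\dot x(t)$ is understood as $\psi(t)$ for $t<s$. Equation $(*)$ is called exponentially stable if there are $M>0$ and $\mu>0$ such that for all $s\ge 0$ and all initial data every solution satisfies $$|x(t)|\le M e^{-\mu(t-s)}\Big[|x_0|+|x_0'|+\sup_{r<s}\big(|\varphi(r)|+|\psi(r)|\big)\Big],\qquad t\ge s.$$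 **Theorem 6.** Suppose that there exist $t_0\ge 0$ and $\delta,\tau\in\mathbb R$ such that $$\inf_{t\ge t_0}a(t)>0,\qquad \inf_{t\ge t_0}b(t)>0,\qquad \Big(\inf_{t\ge t_0}a(t)\Big)^2\ge 4\sup_{t\ge t_0}b(t)$$ (essential infima and suprema), and $t-g(t)\le\delta$, $t-h(t)\le\tau$ for all $t\ge t_0$. Let $\|\cdot\|$ be the norm of $L_\infty[t_0,\infty)$. If $\left\|\frac{a_1}{a}\right\|<1$ and $$\left\|\frac{a_1}{b}\right\|\,\frac{\left\|\frac{b}{a}\right\|+\left\|\frac{b_1}{a}\right\|}{1-\left\|\frac{a_1}{a}\right\|}+\left\|\frac{b_1}{b}\right\|<1,$$ then equation $(*)$ is exponentially stable. -/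

import Mathlib

open MeasureTheory Set

/-- The `L_∞[T, ∞)`-norm of a real function (its essential supremum norm on the half-line). -/
noncomputable def linftyNorm (T : ℝ) (f : ℝ → ℝ) : ℝ :=
  (eLpNorm f ⊤ (volume.restrict (Ici T))).toReal

/-- A coefficient: a Lebesgue measurable, essentially bounded function on `[0, ∞)`. -/
def IsCoefficient (c : ℝ → ℝ) : Prop :=
  MemLp c ⊤ (volume.restrict (Ici 0))

/-- A delayed argument: a Lebesgue measurable function `g` on `[0, ∞)` with `g t ≤ t`. -/
def IsDelayedArgument (g : ℝ → ℝ) : Prop :=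
  AEMeasurable g (volume.restrict (Ici 0)) ∧ ∀ t, 0 ≤ t → g t ≤ t

/-- An initial function: a Borel measurable bounded function on `(-∞, t₀)`. -/
def IsInitialFunction {t₀ : ℝ} (φ : Iio t₀ → ℝ) : Prop :=
  Measurable φ ∧ ∃ C : ℝ, ∀ t, |φ t| ≤ C

/-- `x`, together with its velocity `v`, solves the initial value problem
`x''(t) + a(t) x'(t) + b(t) x(t) + a₁(t) x'(g(t)) + b₁(t) x(h(t)) = 0` for `t ≥ t₀`,
`x(t) = φ(t)`, `x'(t) = ψ(t)` for `t < t₀`, `x(t₀) = x₀`, `x'(t₀) = x₀'`.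
On `[t₀, ∞)` the function `v` is the derivative of `x` (one-sided at `t₀`) and is locally
absolutely continuous. On `(-∞, t₀)`, where the prescribed `ψ` need not be the derivative of the
prescribed `φ`, the function `v` is the prescribed `ψ`; this is the meaning of `x'(g(t))` when
`g(t) < t₀`. -/
structure IsSolution (a b a₁ b₁ g h : ℝ → ℝ) (t₀ : ℝ) (φ ψ : Iio t₀ → ℝ) (x₀ x₀' : ℝ)
    (x v : ℝ → ℝ) : Prop where
  history : ∀ t : Iio t₀, x t = φ t
  history_velocity : ∀ t : Iio t₀, v t = ψ t
  initial : x t₀ = x₀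
  initial_velocity : v t₀ = x₀'
  hasDerivWithinAt : ∀ t, t₀ ≤ t → HasDerivWithinAt x (v t) (Ici t₀) t
  absolutelyContinuous : ∀ t, t₀ ≤ t → AbsolutelyContinuousOnInterval v t₀ t
  equation : ∀ᵐ t ∂volume.restrict (Ici t₀), ∃ w : ℝ, HasDerivAt v w t ∧
    w + a t * v t + b t * x t + a₁ t * v (g t) + b₁ t * x (h t) = 0

/-- (Uniform) exponential stability of
`x''(t) + a(t) x'(t) + b(t) x(t) + a₁(t) x'(g(t)) + b₁(t) x(h(t)) = 0`:
the constants `M` and `μ` depend neither on the initial point `t₀` nor on the initial data. -/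
def IsExponentiallyStable (a b a₁ b₁ g h : ℝ → ℝ) : Prop :=
  ∃ M : ℝ, 0 < M ∧ ∃ μ : ℝ, 0 < μ ∧
    ∀ t₀ : ℝ, 0 ≤ t₀ → ∀ φ ψ : Iio t₀ → ℝ, IsInitialFunction φ → IsInitialFunction ψ →
      ∀ x₀ x₀' : ℝ, ∀ x v : ℝ → ℝ, IsSolution a b a₁ b₁ g h t₀ φ ψ x₀ x₀' x v →
        ∀ t, t₀ ≤ t →
          |x t| ≤ M * Real.exp (-μ * (t - t₀)) *
            (|x₀| + |x₀'| + ⨆ s : Iio t₀, (|φ s| + |ψ s|))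

/-! Write `A` for the essential infimum of `a`, and put `u = v + (A/2) x` with `v = x'`. The
equation splits into three scalar first-order relations: `x' + (A/2) x = u`, `v' + a v = -b x - a₁
v(g) - b₁ x(h)`, `u' + (a - A/2) u = (a A/2 - A²/4 - b) x - a₁ v(g) - b₁ x(h)`. The condition `A² ≥
4 sup b` makes the coefficient of `x` in the last relation nonnegative. If `|x| ≤ P` and `|v| ≤ ρ
P`, past values included, the norm conditions bound the last two right-hand sides by less than `a ρ
P` and `(a - A/2)(A/2) P`, for `ρ` slightly above `(‖b/a‖ + ‖b₁/a‖) / (1 - ‖a₁/a‖)`. The box for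
`(x, v, u)` is therefore invariant. The slack and the bounded delays let it shrink like `exp (-μ t)`
for small `μ > 0` (`exists_decay_rate`, `abs_lt_exp_decay_of_delay_equation`). Invariance is a
first-exit argument (`abs_lt_exp_barrier_of_family`). Before the hypotheses take effect,
`abs_lt_exp_growth_of_delay_equation` controls the solution. -/

/-! ### Exponential barriers for absolutely continuous functions. -/

/-- The gap `z` between barrier and `y` satisfies `z' + α z ≥ 0`. Since `z ≥ 0`, `α` may be raised
to the constant `C`, so `exp (C r) z` is nondecreasing and stays positive. No integrability of `α`
is needed. -/
theorem lt_exp_barrier_of_ae_deriv_le {y : ℝ → ℝ} {k ν s t C : ℝ} (hst : s ≤ t)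
    (hy : AbsolutelyContinuousOnInterval y s t) (h0 : y s < k)
    (hle : ∀ r ∈ Icc s t, y r ≤ k * Real.exp (ν * (r - s)))
    (hd : ∀ᵐ r, r ∈ Ioc s t → ∃ w α, HasDerivAt y w r ∧ α ≤ C ∧
      w + α * y r ≤ (α + ν) * (k * Real.exp (ν * (r - s)))) :
    y t < k * Real.exp (ν * (t - s)) := by
  have hexp (c : ℝ) : AbsolutelyContinuousOnInterval (fun r => Real.exp (c * (r - s))) s t :=
    ContDiffOn.absolutelyContinuousOnInterval (by fun_prop)
  have hexp' (c r : ℝ) : HasDerivAt (fun r => Real.exp (c * (r - s)))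
      (Real.exp (c * (r - s)) * c) r := by
    simpa using (((hasDerivAt_id r).sub_const s).const_mul c).exp
  have hF := (hexp C).fun_mul (((hexp ν).const_mul k).fun_sub hy)
  have hnonneg : 0 ≤ ∫ r in s..t, deriv (fun r => Real.exp (C * (r - s)) *
      (k * Real.exp (ν * (r - s)) - y r)) r := by
    refine intervalIntegral.integral_nonneg_of_ae_restrict hst ?_
    rw [← restrict_Ioc_eq_restrict_Icc]
    refine (ae_restrict_iff' measurableSet_Ioc).2 ?_
    filter_upwards [hd] with r hr hmem
    obtain ⟨w, α, hw, hα, hineq⟩ := hr hmem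
    have hder := (hexp' C r).fun_mul (((hexp' ν r).const_mul k).fun_sub hw)
    have hz : 0 ≤ k * Real.exp (ν * (r - s)) - y r := sub_nonneg.2 (hle r (Ioc_subset_Icc_self hmem))
    have : deriv (fun r => Real.exp (C * (r - s)) * (k * Real.exp (ν * (r - s)) - y r)) r
        = Real.exp (C * (r - s)) * (C * (k * Real.exp (ν * (r - s)) - y r) +
          (ν * (k * Real.exp (ν * (r - s))) - w)) := by
      refine Eq.trans hder.deriv ?_
      ring
    rw [this]
    refine mul_nonneg (Real.exp_pos _).le ?_
    nlinarith [mul_nonneg (sub_nonneg.2 hα) hz]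
  rw [hF.integral_deriv_eq_sub] at hnonneg
  simp only [sub_self, mul_zero, Real.exp_zero, one_mul, mul_one] at hnonneg
  have hpos : 0 < Real.exp (C * (t - s)) * (k * Real.exp (ν * (t - s)) - y t) := by linarith
  exact sub_pos.1 (pos_of_mul_pos_right hpos (Real.exp_pos _).le)

theorem abs_lt_exp_barrier_of_ae_deriv_le {y : ℝ → ℝ} {k ν s t C : ℝ} (hst : s ≤ t)
    (hy : AbsolutelyContinuousOnInterval y s t) (h0 : |y s| < k)
    (hle : ∀ r ∈ Icc s t, |y r| ≤ k * Real.exp (ν * (r - s)))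
    (hd : ∀ᵐ r, r ∈ Ioc s t → ∃ w α, HasDerivAt y w r ∧ α ≤ C ∧
      |w + α * y r| ≤ (α + ν) * (k * Real.exp (ν * (r - s)))) :
    |y t| < k * Real.exp (ν * (t - s)) := by
  refine abs_lt.2 ⟨?_, ?_⟩
  · rw [neg_lt]
    refine lt_exp_barrier_of_ae_deriv_le (y := fun r => -y r) (C := C) hst hy.fun_neg
      (by linarith [neg_abs_le (y s)]) (fun r hr => (neg_le_abs _).trans (hle r hr)) ?_
    filter_upwards [hd] with r hr hmem
    obtain ⟨w, α, hw, hα, h⟩ := hr hmem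
    exact ⟨-w, α, hw.fun_neg, hα, by linarith [(abs_le.1 h).1]⟩
  · refine lt_exp_barrier_of_ae_deriv_le (C := C) hst hy
      ((le_abs_self _).trans_lt h0) (fun r hr => (le_abs_self _).trans (hle r hr)) ?_
    filter_upwards [hd] with r hr hmem
    obtain ⟨w, α, hw, hα, h⟩ := hr hmem
    exact ⟨w, α, hw, hα, (abs_le.1 h).2⟩

/-- Invariance of an exponentially moving box: if every coordinate obeys the barrier inequality
as long as the whole family has stayed in the box, then the family never leaves the box. -/
theorem abs_lt_exp_barrier_of_family {ι : Type*} [Finite ι] {y : ι → ℝ → ℝ} {k : ι → ℝ}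
    {ν s C : ℝ} (hac : ∀ i t, s ≤ t → AbsolutelyContinuousOnInterval (y i) s t)
    (h0 : ∀ i, |y i s| < k i)
    (hd : ∀ i, ∀ᵐ r, s < r →
      (∀ j, ∀ q ∈ Icc s r, |y j q| ≤ k j * Real.exp (ν * (q - s))) →
      ∃ w α, HasDerivAt (y i) w r ∧ α ≤ C ∧
        |w + α * y i r| ≤ (α + ν) * (k i * Real.exp (ν * (r - s)))) (i : ι) {t : ℝ} (ht : s ≤ t) :
    |y i t| < k i * Real.exp (ν * (t - s)) := by
  by_contra! hbad
  have hcont (j : ι) (T : ℝ) (hT : s ≤ T) : ContinuousOn (y j) (Icc s T) := by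
    simpa [uIcc_of_le hT] using (hac j T hT).continuousOn
  have hE (j : ι) : Continuous fun q => k j * Real.exp (ν * (q - s)) := by fun_prop
  -- The times at which some coordinate reaches its barrier. Finiteness of the family makes this set
  -- compact, so there is a first such time `t₁`.
  set Z : Set ℝ := ⋃ j, {q ∈ Icc s t | k j * Real.exp (ν * (q - s)) ≤ |y j q|} with hZ
  have hZcl : IsClosed Z := isClosed_iUnion_of_finite fun j =>
    isClosed_Icc.isClosed_le (hE j).continuousOn (hcont j t ht).abs
  have hZsub : Z ⊆ Icc s t := iUnion_subset fun j => sep_subset _ _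
  have hZc : IsCompact Z := isCompact_Icc.of_isClosed_subset hZcl hZsub
  obtain ⟨t₁, ht₁, hleast⟩ := hZc.exists_isLeast ⟨t, mem_iUnion.2 ⟨i, ⟨ht, le_rfl⟩, hbad⟩⟩
  obtain ⟨i₁, hi₁⟩ := mem_iUnion.1 ht₁
  have hst₁ : s ≤ t₁ := (hZsub ht₁).1
  have hlt : s < t₁ := by
    refine lt_of_le_of_ne hst₁ fun h => ?_
    have := hi₁.2
    rw [← h] at this
    simp only [sub_self, mul_zero, Real.exp_zero, mul_one] at this
    exact absurd (h0 i₁) this.not_gt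
  have hbefore : ∀ j, ∀ q ∈ Ico s t₁, |y j q| ≤ k j * Real.exp (ν * (q - s)) := by
    intro j q hq
    by_contra! hj
    exact absurd (hleast (mem_iUnion.2 ⟨j, ⟨hq.1, hq.2.le.trans (hZsub ht₁).2⟩, hj.le⟩))
      hq.2.not_ge
  have hall : ∀ j, ∀ q ∈ Icc s t₁, |y j q| ≤ k j * Real.exp (ν * (q - s)) := by
    intro j q hq
    have hq' : q ∈ closure (Ico s t₁) := by rwa [closure_Ico hlt.ne]
    exact ContinuousWithinAt.closure_le hq'
      (((hcont j t₁ hst₁).abs q hq).mono Ico_subset_Icc_self)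
      (hE j).continuousWithinAt (hbefore j)
  refine absurd (abs_lt_exp_barrier_of_ae_deriv_le (C := C) hst₁ (hac i₁ t₁ hst₁) (h0 i₁)
    (hall i₁) ?_) hi₁.2.not_gt
  filter_upwards [hd i₁] with r hr hmem
  exact hr hmem.1 fun j q hq => hall j q ⟨hq.1, hq.2.trans hmem.2⟩

/-! ### Regularity of solutions and essential bounds of coefficients. -/

theorem absolutelyContinuousOnInterval_of_hasDerivWithinAt {x v : ℝ → ℝ} {s t : ℝ} (hst : s ≤ t)
    (hx : ∀ r ∈ Icc s t, HasDerivWithinAt x (v r) (Icc s t) r)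
    (hv : ContinuousOn v (Icc s t)) : AbsolutelyContinuousOnInterval x s t := by
  obtain ⟨C, hC⟩ := isCompact_Icc.exists_bound_of_continuousOn hv
  refine LipschitzOnWith.absolutelyContinuousOnInterval (K := C.toNNReal) ?_
  rw [uIcc_of_le hst]
  refine (convex_Icc s t).lipschitzOnWith_of_nnnorm_hasDerivWithin_le hx fun r hr => ?_
  rw [← NNReal.coe_le_coe, coe_nnnorm]
  exact (hC r hr).trans (Real.le_coe_toNNReal C)

theorem IsCoefficient.exists_ae_abs_le {c : ℝ → ℝ} (hc : IsCoefficient c) :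
    ∃ C : ℝ, 0 ≤ C ∧ ∀ᵐ t ∂volume.restrict (Ici 0), |c t| ≤ C := by
  refine ⟨(eLpNorm c ⊤ (volume.restrict (Ici 0))).toReal, ENNReal.toReal_nonneg, ?_⟩
  have hfin : eLpNormEssSup c (volume.restrict (Ici 0)) ≠ ⊤ := by
    rw [← eLpNorm_exponent_top]; exact hc.2.ne
  rw [eLpNorm_exponent_top]
  filter_upwards [ae_le_eLpNormEssSup (f := c) (μ := volume.restrict (Ici 0))] with t ht
  rw [← Real.norm_eq_abs, ← toReal_enorm]
  exact ENNReal.toReal_mono hfin ht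

theorem ae_abs_le_linftyNorm_div_mul {T C d : ℝ} {f e : ℝ → ℝ} (hd : 0 < d)
    (hf : ∀ᵐ t ∂volume.restrict (Ici T), |f t| ≤ C)
    (he : ∀ᵐ t ∂volume.restrict (Ici T), d ≤ e t) :
    ∀ᵐ t ∂volume.restrict (Ici T), |f t| ≤ linftyNorm T (fun t => f t / e t) * e t := by
  -- Finiteness is essential: an infinite norm would become `0` under `toReal`.
  have hfin : eLpNormEssSup (fun t => f t / e t) (volume.restrict (Ici T)) ≠ ⊤ := by
    refine (eLpNormEssSup_lt_top_of_ae_bound (C := C / d) ?_).ne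
    filter_upwards [hf, he] with t ht ht'
    rw [Real.norm_eq_abs, abs_div, abs_of_pos (hd.trans_le ht')]
    exact div_le_div₀ ((abs_nonneg _).trans ht) ht hd ht'
  filter_upwards [ae_le_eLpNormEssSup (f := fun t => f t / e t) (μ := volume.restrict (Ici T)), he]
    with t ht ht'
  have hpos := hd.trans_le ht'
  have h1 : |f t / e t| ≤ linftyNorm T (fun t => f t / e t) := by
    rw [linftyNorm, eLpNorm_exponent_top, ← Real.norm_eq_abs, ← toReal_enorm]
    exact ENNReal.toReal_mono hfin ht
  rwa [abs_div, abs_of_pos hpos, div_le_iff₀ hpos] at h1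

/-! ### Growth and decay of solutions. -/

/-- Solutions of a delay equation with bounded coefficients grow at most exponentially. -/
theorem abs_lt_exp_growth_of_delay_equation {a b a₁ b₁ g h x v : ℝ → ℝ} {s N L : ℝ} (hL : 1 ≤ L)
    (hN : 0 ≤ N)
    (hg : ∀ t, s ≤ t → g t ≤ t) (hh : ∀ t, s ≤ t → h t ≤ t)
    (hbound : ∀ᵐ t ∂volume.restrict (Ici s), |a t| + |b t| + |a₁ t| + |b₁ t| ≤ L)
    (hx : ∀ t, s ≤ t → HasDerivWithinAt x (v t) (Ici s) t)
    (hv : ∀ t, s ≤ t → AbsolutelyContinuousOnInterval v s t)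
    (heq : ∀ᵐ t ∂volume.restrict (Ici s), ∃ w : ℝ, HasDerivAt v w t ∧
      w + a t * v t + b t * x t + a₁ t * v (g t) + b₁ t * x (h t) = 0)
    (hxs : ∀ t, t < s → |x t| ≤ N) (hvs : ∀ t, t < s → |v t| ≤ N)
    (hx0 : |x s| < N) (hv0 : |v s| < N) {t : ℝ} (ht : s ≤ t) :
    |x t| < N * Real.exp (L * (t - s)) ∧ |v t| < N * Real.exp (L * (t - s)) := by
  have hxac (t : ℝ) (ht : s ≤ t) : AbsolutelyContinuousOnInterval x s t :=
    absolutelyContinuousOnInterval_of_hasDerivWithinAt ht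
      (fun r hr => (hx r hr.1).mono Icc_subset_Ici_self)
      (by simpa [uIcc_of_le ht] using (hv t ht).continuousOn)
  have key := abs_lt_exp_barrier_of_family (ι := Bool) (y := fun i => cond i v x)
    (k := fun _ => N) (ν := L) (s := s) (C := 0)
    (fun i t ht => by cases i <;> simp [hxac t ht, hv t ht])
    (fun i => by cases i <;> simp [hx0, hv0]) ?_
  · exact ⟨key false ht, key true ht⟩
  intro i
  rw [ae_restrict_iff' measurableSet_Ici] at hbound heq
  filter_upwards [hbound, heq] with r hb he hsr hbox
  have hpast (q : ℝ) (hq : q ≤ r) :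
      |x q| ≤ N * Real.exp (L * (r - s)) ∧ |v q| ≤ N * Real.exp (L * (r - s)) := by
    rcases lt_or_ge q s with h1 | h1
    · have h2 : (1 : ℝ) ≤ Real.exp (L * (r - s)) :=
        Real.one_le_exp (mul_nonneg (by linarith) (by linarith))
      have h3 : N ≤ N * Real.exp (L * (r - s)) := le_mul_of_one_le_right hN h2
      exact ⟨(hxs q h1).trans h3, (hvs q h1).trans h3⟩
    · have h2 : N * Real.exp (L * (q - s)) ≤ N * Real.exp (L * (r - s)) := by
        gcongr
      exact ⟨(hbox false q ⟨h1, hq⟩).trans h2, (hbox true q ⟨h1, hq⟩).trans h2⟩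
  set B := N * Real.exp (L * (r - s)) with hB
  have hB0 : 0 ≤ B := by positivity
  cases i
  -- With `α = 0` and `ν = L` the requirement is `|x'| ≤ L B`; for `x' = v` this is where `1 ≤ L`
  -- enters.
  · refine ⟨v r, 0, (hx r hsr.le).hasDerivAt (Ici_mem_nhds hsr), le_rfl, ?_⟩
    simp only [zero_mul, add_zero, zero_add]
    nlinarith [(hpast r le_rfl).2]
  · obtain ⟨w, hw, hw0⟩ := he hsr.le
    refine ⟨w, 0, hw, le_rfl, ?_⟩
    simp only [zero_mul, add_zero, zero_add]
    have hw1 : w = -(a r * v r) - b r * x r - a₁ r * v (g r) - b₁ r * x (h r) := by linarith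
    have e1 : |a r * v r| ≤ |a r| * B := by
      rw [abs_mul]; gcongr; exact (hpast r le_rfl).2
    have e2 : |b r * x r| ≤ |b r| * B := by
      rw [abs_mul]; gcongr; exact (hpast r le_rfl).1
    have e3 : |a₁ r * v (g r)| ≤ |a₁ r| * B := by
      rw [abs_mul]; gcongr; exact (hpast _ (hg r hsr.le)).2
    have e4 : |b₁ r * x (h r)| ≤ |b₁ r| * B := by
      rw [abs_mul]; gcongr; exact (hpast _ (hh r hsr.le)).1
    have e5 := mul_le_mul_of_nonneg_right (hb hsr.le) hB0
    rw [abs_le] at *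
    constructor <;> linarith

/-- Constants for the decay estimate: `μ` is the decay rate and `ρ` the ratio between the barriers
for the velocity and for the solution. -/
theorem exists_decay_rate {p q r m n δ τ A C d : ℝ} (hA : 0 < A)
    (hp : p < 1) (hq : 0 ≤ q) (hr : 0 ≤ r)
    (hmain : m * ((q + r) / (1 - p)) + n < 1) :
    ∃ ρ > 0, ∃ μ > 0, μ < A / 2 ∧
      q + r * Real.exp (μ * τ) + p * Real.exp (μ * δ) * ρ ≤ (1 - μ / A) * ρ ∧
      m * Real.exp (μ * δ) * ρ + n * Real.exp (μ * τ) ≤ 1 - μ * C / d := by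
  have hp' : 0 < 1 - p := by linarith
  set ρ₀ := (q + r) / (1 - p) with hρ₀
  have hρ₀0 : 0 ≤ ρ₀ := by positivity
  -- The two strict inequalities are the case `μ = 0` of the final estimates, since `ρ₀ < ρ` means
  -- `q + r + p ρ < ρ`. They persist for small `μ > 0` by continuity.
  obtain ⟨ρ, hρ₁, hρ₂⟩ : ∃ ρ, m * ρ + n < 1 ∧ ρ₀ < ρ := by
    have hc : Filter.Tendsto (fun ρ => m * ρ + n) (nhdsWithin ρ₀ (Ioi ρ₀)) (nhds (m * ρ₀ + n)) :=
      (Continuous.tendsto (by fun_prop) _).mono_left nhdsWithin_le_nhds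
    exact ((hc.eventually_lt_const hmain).and self_mem_nhdsWithin).exists
  have hρ : 0 < ρ := hρ₀0.trans_lt hρ₂
  have hfirst : q + r + p * ρ < ρ := by
    rw [hρ₀, div_lt_iff₀ hp'] at hρ₂
    linarith
  have h1 : ∀ᶠ μ in nhdsWithin (0 : ℝ) (Ioi 0),
      q + r * Real.exp (μ * τ) + p * Real.exp (μ * δ) * ρ < (1 - μ / A) * ρ := by
    have hl : Continuous fun μ : ℝ => q + r * Real.exp (μ * τ) + p * Real.exp (μ * δ) * ρ := by
      fun_prop
    have hr : Continuous fun μ : ℝ => (1 - μ / A) * ρ := by fun_prop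
    exact nhdsWithin_le_nhds ((isOpen_lt hl hr).mem_nhds (by simpa using hfirst))
  have h2 : ∀ᶠ μ in nhdsWithin (0 : ℝ) (Ioi 0),
      m * Real.exp (μ * δ) * ρ + n * Real.exp (μ * τ) < 1 - μ * C / d := by
    have hl : Continuous fun μ : ℝ => m * Real.exp (μ * δ) * ρ + n * Real.exp (μ * τ) := by
      fun_prop
    have hr : Continuous fun μ : ℝ => 1 - μ * C / d := by fun_prop
    exact nhdsWithin_le_nhds ((isOpen_lt hl hr).mem_nhds (by simpa using hρ₁))
  have h3 : ∀ᶠ μ in nhdsWithin (0 : ℝ) (Ioi 0), μ < A / 2 :=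
    Filter.Eventually.filter_mono nhdsWithin_le_nhds (eventually_lt_nhds (by positivity))
  obtain ⟨μ, h1, h2, h3, h4⟩ := (h1.and (h2.and (h3.and self_mem_nhdsWithin))).exists
  exact ⟨ρ, hρ, μ, h4, h3, h1.le, h2.le⟩

/-- Exponential decay of a solution that is bounded by `H` up to the time `S`, by means of barriers
for `x`, for `v = x'` and for `v + (A / 2) x`. -/
theorem abs_lt_exp_decay_of_delay_equation {a b a₁ b₁ g h x v : ℝ → ℝ}
    {S H A C B d δ τ p q r m n ρ μ κ : ℝ}
    (hA : 0 < A) (hd : 0 < d) (hAB : 4 * B ≤ A ^ 2)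
    (hρ : 0 < ρ) (hμ : 0 < μ) (hμA : μ < A / 2)
    (hv_const : q + r * Real.exp (μ * τ) + p * Real.exp (μ * δ) * ρ ≤ (1 - μ / A) * ρ)
    (hx_const : m * Real.exp (μ * δ) * ρ + n * Real.exp (μ * τ) ≤ 1 - μ * C / d)
    (hκ : 1 < κ) (hκρ : 1 < ρ * κ) (hκA : 1 + A / 2 < (A / 2 - μ) * κ) (hH : 0 < H)
    (hg : ∀ t, S ≤ t → g t ≤ t) (hh : ∀ t, S ≤ t → h t ≤ t)
    (hδ : ∀ t, S ≤ t → t - g t ≤ δ) (hτ : ∀ t, S ≤ t → t - h t ≤ τ)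
    (haA : ∀ᵐ t ∂volume.restrict (Ici S), A ≤ a t)
    (haC : ∀ᵐ t ∂volume.restrict (Ici S), a t ≤ C)
    (hbd : ∀ᵐ t ∂volume.restrict (Ici S), d ≤ b t)
    (hbB : ∀ᵐ t ∂volume.restrict (Ici S), b t ≤ B)
    (ha₁a : ∀ᵐ t ∂volume.restrict (Ici S), |a₁ t| ≤ p * a t)
    (hba : ∀ᵐ t ∂volume.restrict (Ici S), |b t| ≤ q * a t)
    (hb₁a : ∀ᵐ t ∂volume.restrict (Ici S), |b₁ t| ≤ r * a t)
    (ha₁b : ∀ᵐ t ∂volume.restrict (Ici S), |a₁ t| ≤ m * b t)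
    (hb₁b : ∀ᵐ t ∂volume.restrict (Ici S), |b₁ t| ≤ n * b t)
    (hx : ∀ t, S ≤ t → HasDerivWithinAt x (v t) (Ici S) t)
    (hv : ∀ t, S ≤ t → AbsolutelyContinuousOnInterval v S t)
    (heq : ∀ᵐ t ∂volume.restrict (Ici S), ∃ w : ℝ, HasDerivAt v w t ∧
      w + a t * v t + b t * x t + a₁ t * v (g t) + b₁ t * x (h t) = 0)
    (hxS : ∀ t, t ≤ S → |x t| ≤ H) (hvS : ∀ t, t ≤ S → |v t| ≤ H) {t : ℝ} (ht : S ≤ t) :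
    |x t| < κ * H * Real.exp (-μ * (t - S)) := by
  have hxac (t : ℝ) (ht : S ≤ t) : AbsolutelyContinuousOnInterval x S t :=
    absolutelyContinuousOnInterval_of_hasDerivWithinAt ht
      (fun r hr => (hx r hr.1).mono Icc_subset_Ici_self)
      (by simpa [uIcc_of_le ht] using (hv t ht).continuousOn)
  have hκ0 : 0 < κ := by linarith
  -- The height `(A / 2 - μ) κ H` is the one for which `x' + (A/2) x = u` meets the barrier
  -- condition with equality. The factor `κ` only puts the values at `S` strictly inside the box.
  have key := abs_lt_exp_barrier_of_family (ι := Fin 3)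
    (y := ![x, v, fun t => v t + A / 2 * x t])
    (k := ![κ * H, ρ * κ * H, (A / 2 - μ) * κ * H]) (ν := -μ) (s := S) (C := C + A) ?_ ?_ ?_
  · exact key 0 ht
  · intro i t ht
    fin_cases i
    · exact hxac t ht
    · exact hv t ht
    · exact (hv t ht).fun_add ((hxac t ht).const_mul _)
  · have h1 := hxS S le_rfl
    have h2 := hvS S le_rfl
    have h3 : |v S + A / 2 * x S| ≤ (1 + A / 2) * H := by
      calc |v S + A / 2 * x S| ≤ |v S| + |A / 2 * x S| := abs_add_le _ _
        _ = |v S| + A / 2 * |x S| := by rw [abs_mul, abs_of_pos (half_pos hA)]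
        _ ≤ H + A / 2 * H := by gcongr
        _ = _ := by ring
    intro i
    fin_cases i
    · exact h1.trans_lt (lt_mul_of_one_lt_left hH hκ)
    · exact h2.trans_lt (lt_mul_of_one_lt_left hH hκρ)
    · exact h3.trans_lt (mul_lt_mul_of_pos_right hκA hH)
  intro i
  rw [ae_restrict_iff' measurableSet_Ici] at haA haC hbd hbB ha₁a hba hb₁a ha₁b hb₁b heq
  filter_upwards [haA, haC, hbd, hbB, ha₁a, hba, hb₁a, ha₁b, hb₁b, heq]
    with t haA haC hbd hbB ha₁a hba hb₁a ha₁b hb₁b heq hSt hbox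
  have hmem : t ∈ Ici S := hSt.le
  replace haA := haA hmem
  replace haC := haC hmem
  replace hbd := hbd hmem
  replace hbB := hbB hmem
  replace ha₁a := ha₁a hmem
  replace hba := hba hmem
  replace hb₁a := hb₁a hmem
  replace ha₁b := ha₁b hmem
  replace hb₁b := hb₁b hmem
  obtain ⟨w, hw, hw0⟩ := heq hmem
  have hxbox (q : ℝ) (h : q ∈ Icc S t) : |x q| ≤ κ * H * Real.exp (-μ * (q - S)) := hbox 0 q h
  have hvbox (q : ℝ) (h : q ∈ Icc S t) : |v q| ≤ ρ * κ * H * Real.exp (-μ * (q - S)) := hbox 1 q h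
  have hubox : |v t + A / 2 * x t| ≤ (A / 2 - μ) * κ * H * Real.exp (-μ * (t - S)) :=
    hbox 2 t ⟨hSt.le, le_rfl⟩
  set E := Real.exp (-μ * (t - S)) with hE
  have hdelay {σ q : ℝ} (hq : t - q ≤ σ) :
      Real.exp (-μ * (q - S)) ≤ Real.exp (μ * σ) * E := by
    rw [hE, ← Real.exp_add]
    refine Real.exp_le_exp.2 ?_
    nlinarith [mul_le_mul_of_nonneg_left hq hμ.le]
  -- Continued to the left of `S`, the barriers only increase, so they also dominate the history.
  have hhist {q : ℝ} (hq : q < S) : 1 ≤ Real.exp (-μ * (q - S)) := by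
    refine Real.one_le_exp ?_
    nlinarith
  have hE0 : 0 < E := Real.exp_pos _
  set P := κ * H * E with hP
  have hP0 : 0 < P := by positivity
  have hvg : |v (g t)| ≤ ρ * Real.exp (μ * δ) * P := by
    have h1 := hdelay (hδ t hSt.le)
    calc |v (g t)| ≤ ρ * κ * H * Real.exp (-μ * (g t - S)) := by
          rcases lt_or_ge (g t) S with h2 | h2
          · refine (hvS _ h2.le).trans ?_
            rw [mul_right_comm]
            exact le_mul_of_one_le_left hH.le (one_le_mul_of_one_le_of_one_le hκρ.le (hhist h2))
          · exact hvbox _ ⟨h2, hg t hSt.le⟩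
      _ ≤ ρ * κ * H * (Real.exp (μ * δ) * E) := by gcongr
      _ = _ := by rw [hP]; ring
  have hxh : |x (h t)| ≤ Real.exp (μ * τ) * P := by
    have h1 := hdelay (hτ t hSt.le)
    calc |x (h t)| ≤ κ * H * Real.exp (-μ * (h t - S)) := by
          rcases lt_or_ge (h t) S with h2 | h2
          · refine (hxS _ h2.le).trans ?_
            rw [mul_right_comm]
            exact le_mul_of_one_le_left hH.le (one_le_mul_of_one_le_of_one_le hκ.le (hhist h2))
          · exact hxbox _ ⟨h2, hh t hSt.le⟩
      _ ≤ κ * H * (Real.exp (μ * τ) * E) := by gcongr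
      _ = _ := by rw [hP]; ring
  have hxt : |x t| ≤ P := hxbox t ⟨hSt.le, le_rfl⟩
  have ha0 : 0 < a t := hA.trans_le haA
  have hb0 : 0 < b t := hd.trans_le hbd
  have hbound {c e z k Z : ℝ} (hc : |c| ≤ k * e) (hz : |z| ≤ Z) : |c * z| ≤ k * e * Z := by
    rw [abs_mul]
    exact mul_le_mul hc hz (abs_nonneg _) ((abs_nonneg _).trans hc)
  have hx' := (hx t hSt.le).hasDerivAt (Ici_mem_nhds hSt)
  fin_cases i
  · refine ⟨v t, A / 2, hx', by linarith, ?_⟩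
    change |v t + A / 2 * x t| ≤ (A / 2 + -μ) * P
    refine hubox.trans (le_of_eq ?_)
    rw [hP]; ring
  · refine ⟨w, a t, hw, by linarith, ?_⟩
    change |w + a t * v t| ≤ (a t + -μ) * (ρ * κ * H * E)
    have e1 := abs_le.1 (hbound ha₁a hvg)
    have e2 := abs_le.1 (hbound hb₁a hxh)
    have e3 := abs_le.1 (hbound hba hxt)
    have e4 := mul_le_mul_of_nonneg_right (mul_le_mul_of_nonneg_left hv_const ha0.le) hP0.le
    -- The loss from the decay rate is absorbed through `a t ≥ A`, which accounts for the term `μ /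
    -- A` in `hv_const`.
    have e5 : μ * ρ * P ≤ a t * (μ / A * ρ) * P := by
      have : 1 ≤ a t / A := (one_le_div hA).2 haA
      have h2 := le_mul_of_one_le_left (by positivity : 0 ≤ μ * ρ * P) this
      refine h2.trans (le_of_eq ?_)
      ring
    have e6 : (a t + -μ) * (ρ * κ * H * E) = a t * ρ * P - μ * ρ * P := by rw [hP]; ring
    rw [e6, abs_le]
    constructor <;> linarith
  · refine ⟨w + A / 2 * v t, a t - A / 2, hw.fun_add (hx'.const_mul _), by linarith, ?_⟩
    change |w + A / 2 * v t + (a t - A / 2) * (v t + A / 2 * x t)| ≤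
      (a t - A / 2 + -μ) * ((A / 2 - μ) * κ * H * E)
    -- The discriminant condition: the expression is at least `A²/4 - B ≥ 0`.
    have hc : 0 ≤ a t * (A / 2) - (A / 2) ^ 2 - b t := by nlinarith
    have e1 := abs_le.1 (hbound ha₁b hvg)
    have e2 := abs_le.1 (hbound hb₁b hxh)
    have e3 := abs_le.1 (hbound (k := 1) (by rw [abs_of_nonneg hc, one_mul]) hxt)
    have e4 := mul_le_mul_of_nonneg_right (mul_le_mul_of_nonneg_left hx_const hb0.le) hP0.le
    -- Here the loss is measured against `b t ≥ d`, using `a t ≤ C`; hence `μ * C / d` in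
    -- `hx_const`.
    have e5 : μ * a t * P ≤ b t * (μ * C / d) * P := by
      have h1 : 1 ≤ b t / d := (one_le_div hd).2 hbd
      have h2 : μ * a t * P ≤ μ * C * P := by gcongr
      have h3 := le_mul_of_one_le_left
        (mul_nonneg (mul_nonneg hμ.le (ha0.le.trans haC)) hP0.le : 0 ≤ μ * C * P) h1
      refine h2.trans (h3.trans (le_of_eq ?_))
      ring
    have e6 : (a t - A / 2 + -μ) * ((A / 2 - μ) * κ * H * E) =
        (a t * (A / 2) - (A / 2) ^ 2 - b t) * P + b t * P - μ * a t * P + μ ^ 2 * P := by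
      rw [hP]; ring
    have e7 : 0 ≤ μ ^ 2 * P := by positivity
    rw [e6, abs_le]
    constructor <;> linarith

/-! ### Exponential stability. -/

theorem theorem6 (a b a₁ b₁ g h : ℝ → ℝ)
    (ha : IsCoefficient a) (hb : IsCoefficient b)
    (ha₁ : IsCoefficient a₁) (hb₁ : IsCoefficient b₁)
    (hg : IsDelayedArgument g) (hh : IsDelayedArgument h)
    (T : ℝ) (hT : 0 ≤ T)
    (ha_pos : 0 < essInf a (volume.restrict (Ici T)))
    (hb_pos : 0 < essInf b (volume.restrict (Ici T)))
    (hab : 4 * essSup b (volume.restrict (Ici T)) ≤ (essInf a (volume.restrict (Ici T))) ^ 2)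
    (δ τ : ℝ) (hδ : ∀ t, T ≤ t → t - g t ≤ δ) (hτ : ∀ t, T ≤ t → t - h t ≤ τ)
    (ha₁a : linftyNorm T (fun t => a₁ t / a t) < 1)
    (hmain : linftyNorm T (fun t => a₁ t / b t) *
          ((linftyNorm T (fun t => b t / a t) + linftyNorm T (fun t => b₁ t / a t)) /
            (1 - linftyNorm T (fun t => a₁ t / a t))) +
        linftyNorm T (fun t => b₁ t / b t) < 1) :
    IsExponentiallyStable a b a₁ b₁ g h := by
  have hae {P : ℝ → Prop} {S S' : ℝ} (hS : S ≤ S') (hP : ∀ᵐ t ∂volume.restrict (Ici S), P t) :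
      ∀ᵐ t ∂volume.restrict (Ici S'), P t :=
    ae_restrict_of_ae_restrict_of_subset (Ici_subset_Ici.2 hS) hP
  obtain ⟨Ca, hCa0, hCa⟩ := ha.exists_ae_abs_le
  obtain ⟨Cb, hCb0, hCb⟩ := hb.exists_ae_abs_le
  obtain ⟨Ca₁, hCa₁0, hCa₁⟩ := ha₁.exists_ae_abs_le
  obtain ⟨Cb₁, hCb₁0, hCb₁⟩ := hb₁.exists_ae_abs_le
  set A := essInf a (volume.restrict (Ici T))
  set B := essSup b (volume.restrict (Ici T))
  set d := essInf b (volume.restrict (Ici T))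
  have haA : ∀ᵐ t ∂volume.restrict (Ici T), A ≤ a t :=
    ae_essInf_le ⟨-Ca, (hae hT hCa).mono fun t ht => (abs_le.1 ht).1⟩
  have hbd : ∀ᵐ t ∂volume.restrict (Ici T), d ≤ b t :=
    ae_essInf_le ⟨-Cb, (hae hT hCb).mono fun t ht => (abs_le.1 ht).1⟩
  have hbB : ∀ᵐ t ∂volume.restrict (Ici T), b t ≤ B :=
    ae_le_essSup ⟨Cb, (hae hT hCb).mono fun t ht => (abs_le.1 ht).2⟩
  have haC : ∀ᵐ t ∂volume.restrict (Ici T), a t ≤ Ca :=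
    (hae hT hCa).mono fun t ht => (abs_le.1 ht).2
  have hba_ae := ae_abs_le_linftyNorm_div_mul ha_pos (hae hT hCb) haA
  have ha₁a_ae := ae_abs_le_linftyNorm_div_mul ha_pos (hae hT hCa₁) haA
  have hb₁a_ae := ae_abs_le_linftyNorm_div_mul ha_pos (hae hT hCb₁) haA
  have ha₁b_ae := ae_abs_le_linftyNorm_div_mul hb_pos (hae hT hCa₁) hbd
  have hb₁b_ae := ae_abs_le_linftyNorm_div_mul hb_pos (hae hT hCb₁) hbd
  obtain ⟨ρ, hρ, μ, hμ, hμA, hv_const, hx_const⟩ := exists_decay_rate (δ := δ) (τ := τ) (C := Ca)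
    (d := d) ha_pos ha₁a ENNReal.toReal_nonneg ENNReal.toReal_nonneg hmain
  have hA2 : 0 < A / 2 - μ := by linarith
  obtain ⟨κ, hκ⟩ := exists_gt (max 1 (max (1 / ρ) ((1 + A / 2) / (A / 2 - μ))))
  simp only [max_lt_iff] at hκ
  obtain ⟨hκ, hκρ, hκA⟩ := hκ
  rw [div_lt_iff₀' hρ] at hκρ
  rw [div_lt_iff₀' hA2] at hκA
  set L := 1 + (Ca + Cb + Ca₁ + Cb₁) with hL_def
  have hL : 1 ≤ L := by linarith
  have hκ0 : 0 < κ := by linarith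
  -- `exp (L * T)` pays for growth on `[s, max s T]`, whose length is at most `T`; `exp (μ * T)`
  -- pays for the decay starting only at `max s T`.
  refine ⟨κ * Real.exp (L * T) * Real.exp (μ * T), by positivity, μ, hμ, ?_⟩
  intro s hs φ ψ hφ hψ x₀ x₀' x v hsol t hst
  obtain ⟨-, Cφ, hCφ⟩ := hφ
  obtain ⟨-, Cψ, hCψ⟩ := hψ
  set N₀ := |x₀| + |x₀'| + ⨆ r : Iio s, (|φ r| + |ψ r|) with hN₀
  have hbdd : BddAbove (range fun r : Iio s => |φ r| + |ψ r|) :=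
    ⟨Cφ + Cψ, by rintro _ ⟨r, rfl⟩; exact add_le_add (hCφ r) (hCψ r)⟩
  have hsup0 : 0 ≤ ⨆ r : Iio s, (|φ r| + |ψ r|) := Real.iSup_nonneg fun r => by positivity
  have hN₀0 : 0 ≤ N₀ := by positivity
  have hhist (r : ℝ) (hr : r < s) : |x r| ≤ N₀ ∧ |v r| ≤ N₀ := by
    have h1 := le_ciSup hbdd (⟨r, hr⟩ : Iio s)
    have h2 := hsol.history ⟨r, hr⟩
    have h3 := hsol.history_velocity ⟨r, hr⟩
    simp only at h1 h2 h3
    rw [h2, h3]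
    constructor <;>
      linarith [abs_nonneg x₀, abs_nonneg x₀', abs_nonneg (φ ⟨r, hr⟩), abs_nonneg (ψ ⟨r, hr⟩)]
  have hbound : ∀ᵐ t ∂volume.restrict (Ici s), |a t| + |b t| + |a₁ t| + |b₁ t| ≤ L := by
    filter_upwards [hae hs hCa, hae hs hCb, hae hs hCa₁, hae hs hCb₁] with t h1 h2 h3 h4
    linarith
  set S := max s T with hS
  have hSs : s ≤ S := le_max_left _ _
  have hTS : T ≤ S := le_max_right _ _
  have hSsT : S - s ≤ T := by
    rcases max_cases s T with h | h <;> linarith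
  -- The barriers need strict initial inequalities, and `N₀` may vanish; hence a larger `N`, later
  -- sent to `N₀`.
  have hmain_bound (N : ℝ) (hN : N₀ < N) :
      |x t| ≤ κ * Real.exp (L * T) * Real.exp (μ * T) * Real.exp (-μ * (t - s)) * N := by
    have hN0 : 0 < N := hN₀0.trans_lt hN
    have hgrowth {r : ℝ} (hr : s ≤ r) := abs_lt_exp_growth_of_delay_equation hL hN0.le
      (fun t ht => hg.2 t (hs.trans ht)) (fun t ht => hh.2 t (hs.trans ht)) hbound
      hsol.hasDerivWithinAt hsol.absolutelyContinuous hsol.equation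
      (fun r hr => (hhist r hr).1.trans hN.le) (fun r hr => (hhist r hr).2.trans hN.le)
      (by rw [hsol.initial]; linarith [abs_nonneg x₀'])
      (by rw [hsol.initial_velocity]; linarith [abs_nonneg x₀]) hr
    set H := N * Real.exp (L * T) with hH
    have hH0 : 0 < H := by positivity
    have hpast (r : ℝ) (hr : r ≤ S) : |x r| ≤ H ∧ |v r| ≤ H := by
      rcases lt_or_ge r s with h1 | h1
      · have h2 : N₀ ≤ H := hN.le.trans
          (le_mul_of_one_le_right hN0.le (Real.one_le_exp (by positivity)))
        exact ⟨(hhist r h1).1.trans h2, (hhist r h1).2.trans h2⟩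
      · have h2 : N * Real.exp (L * (r - s)) ≤ H := by
          rw [hH]
          gcongr
          linarith
        exact ⟨(hgrowth h1).1.le.trans h2, (hgrowth h1).2.le.trans h2⟩
    have hshift {c : ℝ} (hc : c ≤ μ * T + -μ * (t - s)) : κ * H * Real.exp c ≤
        κ * Real.exp (L * T) * Real.exp (μ * T) * Real.exp (-μ * (t - s)) * N := by
      calc κ * H * Real.exp c ≤ κ * H * Real.exp (μ * T + -μ * (t - s)) := by gcongr
        _ = _ := by rw [hH, Real.exp_add]; ring
    rcases le_or_gt t S with htS | htS
    · have h1 : κ * H ≤ κ * H * Real.exp 0 := by simp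
      refine (hpast t htS).1.trans ((le_mul_of_one_le_left hH0.le hκ.le).trans
        (h1.trans (hshift ?_)))
      nlinarith
    · have hdecay := abs_lt_exp_decay_of_delay_equation (S := S) (H := H) (a := a) (b := b)
        (a₁ := a₁) (b₁ := b₁) (g := g) (h := h) (x := x) (v := v) ha_pos hb_pos hab hρ hμ hμA
        hv_const hx_const hκ hκρ hκA hH0
        (fun t ht => hg.2 t (hs.trans (hSs.trans ht))) (fun t ht => hh.2 t (hs.trans (hSs.trans ht)))
        (fun t ht => hδ t (hTS.trans ht)) (fun t ht => hτ t (hTS.trans ht))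
        (hae hTS haA) (hae hTS haC) (hae hTS hbd) (hae hTS hbB) (hae hTS ha₁a_ae) (hae hTS hba_ae)
        (hae hTS hb₁a_ae) (hae hTS ha₁b_ae) (hae hTS hb₁b_ae)
        (fun t ht => (hsol.hasDerivWithinAt t (hSs.trans ht)).mono (Ici_subset_Ici.2 hSs))
        (fun t ht => (hsol.absolutelyContinuous t (hSs.trans ht)).mono (by
          rw [uIcc_of_le ht, uIcc_of_le (hSs.trans ht)]
          exact Icc_subset_Icc_left hSs))
        (hae hSs hsol.equation) (fun r hr => (hpast r hr).1) (fun r hr => (hpast r hr).2) htS.le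
      refine hdecay.le.trans (hshift ?_)
      nlinarith
  refine le_of_forall_pos_le_add fun ε hε => ?_
  set M := κ * Real.exp (L * T) * Real.exp (μ * T) * Real.exp (-μ * (t - s)) with hM
  have hM0 : 0 < M := by positivity
  have h1 := hmain_bound (N₀ + ε / M) (by linarith [div_pos hε hM0])
  rwa [mul_add, mul_div_cancel₀ _ hM0.ne'] at h1
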